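/- Let $X$ be an arbitrary Polish space (not necessarily compact), let $f : X \to \mathbb{R}$ be a bounded function of Baire class $1$ (a pointwise limit of a sequence of continuous functions), and let $1 \le \lambda < \omega_1$ be an ordinal. Then $$f \in \mathscr{B}_1^\lambda \iff \operatorname{length}_1(f) \le \omega^\lambda ,$$ and, equivalently, $f \in \mathscr{B}_1^\lambda$ if and only if $f$ is the sum of a constant and an alternating sequence from $DUSB_1$ of some length at most $\omega^\lambda$. The notions are as follows. An ordinal is even if it is of the form $\delta + 2n$ with $\delta$ zero or a limit ordinal and $n \in \mathbb{N}$, and $(-1)^\eta$ is $1$ if $\eta$ is even and $-1$ otherwise. *The class $\mathscr{B}_1^\lambda$.* For $A, B \subseteq X$ let $\alpha_1(A,B)$ be the least ordinal $\mu < \omega_1$ for which there is a decreasing sequence $(F_\eta)_{\eta<\mu}$ of closed subsets of $X$ with $F_0 = X$, with $F_\theta = \bigcap_{\eta<\theta} F_\eta$ for every limit $\theta < \mu$, with $\bigcap_{\eta<\mu} F_\eta = \emptyset$ if $\mu$ is a limit, and with $$A \subseteq \bigcup_{\eta<\mu,\ \eta \text{ even}} F_\eta \setminus F_{\eta+1}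 \subseteq X \setminus B ,$$ where $F_\eta = \emptyset$ for $\eta \ge \mu$; put $\alpha_1(A,B) = \omega_1$ if there is no such $\mu$. Let $\alpha_1(f) = \sup\{\alpha_1(\{f \le p\}, \{f \ge q\}) : p < q,\ p,q \in \mathbb{Q}\}$. Then $\mathscr{B}_1^\lambda$ is the set of bounded Baire class $1$ functions $f$ on $X$ with $\alpha_1(f) \le \omega^\lambda$. *Alternating sums.* $DUSB_1$ is the set of transfinite sequences $(f_\eta)_{\eta<\mu}$, of length $\mu < \omega_1$, of bounded non-negative upper semicontinuous functions on $X$ that are pointwise decreasing and, if $\mu$ is a limit ordinal, satisfy $f_\eta \to 0$ pointwise as $\eta \to \mu$. For such a sequence $\sum^*_{\eta<\theta} (-1)^\eta f_\eta$ is defined by recursion on $\theta \le \mu$: it is $0$ for $\theta = 0$; $\sum^*_{\eta<\theta+1} (-1)^\eta f_\eta = \sum^*_{\eta<\theta} (-1)^\eta f_\eta + (-1)^\theta f_\theta$; and for limit $\theta$ it is the pointwise supremum of $\sum^*_{\eta<\zeta} (-1)^\eta f_\eta$ over all even $\zeta < \theta$. The function $f$ is the sum of a constant and the alternating sequence $(f_\eta)_{\eta<\mu}$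 if $f = c + \sum^*_{\eta<\mu} (-1)^\eta f_\eta$ for some $c \in \mathbb{R}$, and $\operatorname{length}_1(f)$ is the least length $\mu$ of such a sequence in $DUSB_1$, or $\omega_1$ if there is none. -/

import Mathlib

open Set Filter Topology
open scoped Ordinal

noncomputable section

namespace AltSum

variable {X : Type*}

/-- Even ordinals: those of the form `δ + 2n` with `δ` zero or a limit ordinal
(i.e. a multiple `ω * μ` of `ω`) and `n` a natural number. -/
def EvenOrd (η : Ordinal.{0}) : Prop :=
  ∃ (μ : Ordinal.{0}) (n : ℕ), η = ω * μ + ((2 * n : ℕ) : Ordinal.{0})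

/-- The sign `(-1)^η`: it is `1` if `η` is even and `-1` if `η` is odd. -/
def ordSign (η : Ordinal.{0}) : ℝ :=
  open Classical in if EvenOrd η then 1 else -1

/-- Bounded real functions. -/
def Bdd (f : X → ℝ) : Prop := ∃ C : ℝ, ∀ x, |f x| ≤ C

/-- Functions of Baire class 1: pointwise limits of sequences of continuous functions. -/
def BaireOne [TopologicalSpace X] (f : X → ℝ) : Prop :=
  ∃ g : ℕ → X → ℝ, (∀ n, Continuous (g n)) ∧ ∀ x, Tendsto (fun n => g n x) atTop (𝓝 (f x))

/-- `F` represents a continuous decreasing sequence `(F_η)_{η < l}` of closed sets of countable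
length `l`, starting with the whole space, with empty intersection if `l` is a limit; it is
continued by `F_η = ∅` for `η ≥ l`. -/
structure IsClosedSeq [TopologicalSpace X] (l : Ordinal.{0}) (F : Ordinal.{0} → Set X) : Prop where
  countable_length : l < ω₁
  isClosed : ∀ η < l, IsClosed (F η)
  decreasing : ∀ η ζ, η ≤ ζ → ζ < l → F ζ ⊆ F η
  continuous : ∀ θ < l, Order.IsSuccLimit θ → F θ = ⋂ η < θ, F η
  zero : F 0 = univ
  inter_eq_empty : Order.IsSuccLimit l → ⋂ η < l, F η = ∅
  eq_empty : ∀ η, l ≤ η → F η = ∅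

/-- `A` and `B` are separated by the transfinite difference of some sequence of closed sets of
length `l`. -/
def SeparatedBy [TopologicalSpace X] (A B : Set X) (l : Ordinal.{0}) : Prop :=
  ∃ F : Ordinal.{0} → Set X, IsClosedSeq l F ∧
    A ⊆ (⋃ η ∈ {η | η < l ∧ EvenOrd η}, F η \ F (η + 1)) ∧
    (⋃ η ∈ {η | η < l ∧ EvenOrd η}, F η \ F (η + 1)) ⊆ Bᶜ

/-- `α₁(A, B)`: the least length of a sequence of closed sets whose transfinite difference
separates `A` from `B`, and `ω₁` if there is none (such lengths are always below `ω₁`). -/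
def sepRank [TopologicalSpace X] (A B : Set X) : Ordinal.{0} :=
  sInf (insert ω₁ {l | SeparatedBy A B l})

/-- The modified separation rank
`α₁(f) = sup {α₁({f ≤ p}, {f ≥ q}) : p < q rational}`. -/
def modSepRank [TopologicalSpace X] (f : X → ℝ) : Ordinal.{0} :=
  ⨆ r : {r : ℚ × ℚ // r.1 < r.2},
    sepRank {x | f x ≤ ((r.1.1 : ℚ) : ℝ)} {x | ((r.1.2 : ℚ) : ℝ) ≤ f x}

/-- The class `𝓑₁^lam` of bounded Baire class 1 functions with `α₁(f) ≤ ω ^ lam`. -/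
def BaireOneRankClass (X : Type*) [TopologicalSpace X] (lam : Ordinal.{0}) : Set (X → ℝ) :=
  {f | BaireOne f ∧ Bdd f ∧ modSepRank f ≤ ω ^ lam}

/-- `(f_η)_{η < l}` belongs to `DUSB₁`: it is a decreasing transfinite sequence of countable
length `l` of bounded non-negative upper semicontinuous functions, which tends pointwise to `0`
as `η → l` if `l` is a limit ordinal.  Only the values `f η` with `η < l` matter. -/
structure IsDUSB [TopologicalSpace X] (l : Ordinal.{0}) (f : Ordinal.{0} → X → ℝ) : Prop where
  countable_length : l < ω₁
  usc : ∀ η < l, UpperSemicontinuous (f η)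
  nonneg : ∀ η < l, ∀ x, 0 ≤ f η x
  bounded : ∀ η < l, Bdd (f η)
  decreasing : ∀ η ζ, η ≤ ζ → ζ < l → ∀ x, f ζ x ≤ f η x
  tendsto_zero : Order.IsSuccLimit l →
    ∀ x, Tendsto (fun η : Iio l => f η.1 x) atTop (𝓝 0)

/-- The alternating sum `∑*_{η < θ} (-1)^η f_η`, by transfinite recursion on `θ`: at successors
the next signed term is added, and at a limit `θ` one takes the pointwise supremum of the sums up
to the even `ζ < θ` (for sequences in `DUSB₁` these are bounded by `f 0`). -/
def altSum (f : Ordinal.{0} → X → ℝ) (θ : Ordinal.{0}) : X → ℝ :=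
  Ordinal.limitRecOn (motive := fun _ => X → ℝ) θ
    (fun _ => 0)
    (fun θ s x => s x + ordSign θ * f θ x)
    (fun θ _ s x => sSup {r : ℝ | ∃ (ζ : Ordinal.{0}) (h : ζ < θ), EvenOrd ζ ∧ r = s ζ h x})

/-- `f` is the sum of a constant and an alternating sequence from `DUSB₁` of length `l`. -/
def IsConstAddAltSum [TopologicalSpace X] (f : X → ℝ) (l : Ordinal.{0}) : Prop :=
  ∃ (g : Ordinal.{0} → X → ℝ) (c : ℝ), IsDUSB l g ∧ ∀ x, f x = c + altSum g l x

/-- `length₁(f)`: the least length of an alternating sequence from `DUSB₁` whose sum with a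
constant is `f`, and `ω₁` if there is none (such lengths are always below `ω₁`). -/
def altLength [TopologicalSpace X] (f : X → ℝ) : Ordinal.{0} :=
  sInf (insert ω₁ {l | IsConstAddAltSum f l})

end AltSum

end

/-! Both conditions on `f` are equivalent to an intermediate one, `OscRank μ f`: for each `ε > 0`
there is an upper semicontinuous rank function below `ω ^ μ` such that, near each point and within
its level, `f` moves by at most `ε`. This is local and stable under sums, since rank functions add
by the natural sum and `ω ^ μ` is closed under it.

Separation gives `OscRank`: cut the bounded range of `f` into finitely many small intervals and
combine the ranks of the separating sequences (`oscRank_of_separatedBy`). Conversely, a rank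
function for a small `ε` yields a closed sequence of length `ω ^ μ` separating the level sets
(`LevelRank.exists_isClosedSeq`), two closed sets being spent on each level; this costs nothing
because `2 * ω ^ μ = ω ^ μ`.

`OscRank` gives an alternating sum: repeatedly subtract a third of the current bound times the
indicator of a separating transfinite difference. This writes `f` plus a constant as a geometric
series of such indicators, each the alternating sum of the indicators of its closed sets. All have
length `ω ^ μ`, so they can be superposed (`altSum_tsum`).

An alternating sum gives `OscRank` by induction on `μ` (`oscRank_altSum_of_lt`): a tail is bounded
by the decrease of the terms. For a block of length `ω ^ μ` the levels of the limit of the terms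
cost one extra factor `ω`; at the full length the terms tend to zero and no factor is lost. -/

noncomputable section

namespace AltSum

/-! ### Natural sums, powers of `ω`, and parity of ordinals. -/

section OrdinalArithmetic

universe u

/-- The natural (Hessenberg) sum of ordinals. -/
def natSum (a b : Ordinal.{u}) : Ordinal.{u} :=
  max (⨆ x : Iio a, Order.succ (natSum x.1 b)) (⨆ x : Iio b, Order.succ (natSum a x.1))
termination_by (a, b)
decreasing_by
  · exact Prod.Lex.left _ _ x.2
  · exact Prod.Lex.right _ x.2

theorem natSum_lt_natSum_left {a a' : Ordinal.{u}} (h : a' < a) (b : Ordinal.{u}) :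
    natSum a' b < natSum a b := by
  conv_rhs => rw [natSum]
  refine lt_max_of_lt_left ((Order.lt_succ _).trans_le ?_)
  exact Ordinal.le_iSup (fun x : Iio a => Order.succ (natSum x.1 b)) ⟨a', h⟩

theorem natSum_lt_natSum_right {b b' : Ordinal.{u}} (a : Ordinal.{u}) (h : b' < b) :
    natSum a b' < natSum a b := by
  conv_rhs => rw [natSum]
  refine lt_max_of_lt_right ((Order.lt_succ _).trans_le ?_)
  exact Ordinal.le_iSup (fun x : Iio b => Order.succ (natSum a x.1)) ⟨b', h⟩

theorem natSum_le {a b c : Ordinal.{u}} (h₁ : ∀ a' < a, natSum a' b < c)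
    (h₂ : ∀ b' < b, natSum a b' < c) : natSum a b ≤ c := by
  rw [natSum]
  exact max_le (Ordinal.iSup_le fun x => Order.succ_le_of_lt (h₁ _ x.2))
    (Ordinal.iSup_le fun x => Order.succ_le_of_lt (h₂ _ x.2))

theorem natSum_mono {a a' b b' : Ordinal.{u}} (ha : a' ≤ a) (hb : b' ≤ b) :
    natSum a' b' ≤ natSum a b := by
  calc natSum a' b' ≤ natSum a b' := by
        rcases ha.eq_or_lt with rfl | h
        · rfl
        · exact (natSum_lt_natSum_left h _).le
    _ ≤ natSum a b := by
        rcases hb.eq_or_lt with rfl | h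
        · rfl
        · exact (natSum_lt_natSum_right _ h).le

/-- Strict monotonicity in both arguments makes this work; the ordinary ordinal sum fails it on the
left. It lets one combined rank detect the levels of both summands. -/
theorem eq_and_eq_of_natSum_eq {a a' b b' : Ordinal.{u}} (ha : a' ≤ a) (hb : b' ≤ b)
    (h : natSum a' b' = natSum a b) : a' = a ∧ b' = b := by
  constructor
  · by_contra hne
    exact absurd h (((natSum_lt_natSum_left (lt_of_le_of_ne ha hne) b').trans_le
      (natSum_mono le_rfl hb)).ne)
  · by_contra hne
    exact absurd h (((natSum_mono ha le_rfl).trans_lt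
      (natSum_lt_natSum_right a (lt_of_le_of_ne hb hne))).ne)

/-- Every ordinal below `κ * k` is `κ * n + r` with `n < k` and `r < κ`. -/
theorem exists_eq_mul_natCast_add {κ a : Ordinal.{u}} (hκ : κ ≠ 0) {k : ℕ} (h : a < κ * k) :
    ∃ n < k, ∃ r < κ, a = κ * (n : ℕ) + r := by
  have h1 : a / κ < k := (Ordinal.lt_mul_iff_div_lt hκ).1 h
  obtain ⟨n, hn⟩ := Ordinal.lt_omega0.1 (h1.trans (Ordinal.natCast_lt_omega0 k))
  refine ⟨n, by rw [hn] at h1; exact_mod_cast h1, a % κ, Ordinal.mod_lt a hκ, ?_⟩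
  rw [← hn, Ordinal.div_add_mod]

theorem mul_natCast_add_lt {κ r : Ordinal.{u}} {m n : ℕ} (hr : r < κ) (h : m < n) :
    κ * (m : Ordinal.{u}) + r < κ * (n : Ordinal.{u}) := by
  calc κ * (m : Ordinal.{u}) + r < κ * m + κ := by gcongr
    _ = κ * ((m + 1 : ℕ) : Ordinal.{u}) := by push_cast; rw [mul_add, mul_one]
    _ ≤ κ * n := by gcongr; exact_mod_cast h

theorem natSum_mul_natCast_add_le {κ : Ordinal.{u}} (hκ : ∀ a < κ, ∀ b < κ, natSum a b < κ)
    {a b : Ordinal.{u}} {m n : ℕ} {r s : Ordinal.{u}} (hr : r < κ) (hs : s < κ)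
    (ha : a = κ * (m : ℕ) + r) (hb : b = κ * (n : ℕ) + s) :
    natSum a b ≤ κ * ((m + n : ℕ) : Ordinal.{u}) + natSum r s := by
  have h0 : κ ≠ 0 := (zero_le.trans_lt hr).ne'
  induction a using WellFoundedLT.induction generalizing b m n r s with
  | _ a iha =>
  induction b using WellFoundedLT.induction generalizing m n r s with
  | _ b ihb =>
  refine natSum_le (fun a' ha' => ?_) (fun b' hb' => ?_)
  · obtain ⟨m', hm', r', hr', rfl⟩ := exists_eq_mul_natCast_add (k := m + 1) h0
      (ha'.trans (ha ▸ mul_natCast_add_lt hr (Nat.lt_succ_self m)))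
    refine (iha _ ha' hr' hs rfl hb).trans_lt ?_
    -- With equal quotients the remainder has dropped; otherwise the quotient has, and the natural
    -- sum of the remainders stays below `κ`.
    rcases (Nat.lt_succ_iff.1 hm').eq_or_lt with rfl | hlt
    · rw [ha] at ha'
      gcongr
      exact natSum_lt_natSum_left ((add_lt_add_iff_left _).1 ha') _
    · exact (mul_natCast_add_lt (hκ _ hr' _ hs) (by omega)).trans_le le_self_add
  · obtain ⟨m', hm', r', hr', rfl⟩ := exists_eq_mul_natCast_add (k := n + 1) h0
      (hb'.trans (hb ▸ mul_natCast_add_lt hs (Nat.lt_succ_self n)))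
    refine (ihb _ hb' hr hr' ha rfl).trans_lt ?_
    rcases (Nat.lt_succ_iff.1 hm').eq_or_lt with rfl | hlt
    · rw [hb] at hb'
      gcongr
      exact natSum_lt_natSum_right _ ((add_lt_add_iff_left _).1 hb')
    · exact (mul_natCast_add_lt (hκ _ hr _ hr') (by omega)).trans_le le_self_add

/-- Powers of `ω` are closed under natural sums. -/
theorem natSum_lt_omega0_opow (μ : Ordinal.{u}) :
    ∀ a < ω ^ μ, ∀ b < ω ^ μ, natSum a b < ω ^ μ := by
  induction μ using Ordinal.limitRecOn with
  | zero =>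
    intro a ha b hb
    simp only [Ordinal.opow_zero, Order.lt_one_iff] at *
    subst ha; subst hb
    exact le_antisymm (natSum_le (fun x hx => absurd hx not_lt_zero)
      (fun x hx => absurd hx not_lt_zero)) zero_le
  | add_one μ ih =>
    intro a ha b hb
    rw [← Order.succ_eq_add_one] at *
    obtain ⟨k, hk⟩ := Ordinal.lt_omega0_opow_succ.1 ha
    obtain ⟨l, hl⟩ := Ordinal.lt_omega0_opow_succ.1 hb
    have h0 : ω ^ μ ≠ 0 := Ordinal.opow_ne_zero _ Ordinal.omega0_ne_zero
    obtain ⟨m, -, r, hr, h1⟩ := exists_eq_mul_natCast_add h0 hk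
    obtain ⟨n, -, s, hs, h2⟩ := exists_eq_mul_natCast_add h0 hl
    exact Ordinal.lt_omega0_opow_succ.2 ⟨m + n + 1,
      (natSum_mul_natCast_add_le ih hr hs h1 h2).trans_lt
      (mul_natCast_add_lt (ih _ hr _ hs) (Nat.lt_succ_self _))⟩
  | limit μ hμ ih =>
    intro a ha b hb
    obtain ⟨c, hc, hac⟩ := (Ordinal.lt_opow_of_isSuccLimit Ordinal.omega0_ne_zero hμ).1 ha
    obtain ⟨d, hd, hbd⟩ := (Ordinal.lt_opow_of_isSuccLimit Ordinal.omega0_ne_zero hμ).1 hb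
    have hm : max c d < μ := max_lt hc hd
    refine (ih _ hm a ?_ b ?_).trans_le (Ordinal.opow_le_opow_right Ordinal.omega0_pos hm.le)
    · exact hac.trans_le (Ordinal.opow_le_opow_right Ordinal.omega0_pos (le_max_left _ _))
    · exact hbd.trans_le (Ordinal.opow_le_opow_right Ordinal.omega0_pos (le_max_right _ _))

theorem two_mul_eq_self_of_isSuccLimit {θ : Ordinal.{u}} (h : Order.IsSuccLimit θ) :
    2 * θ = θ :=
  Ordinal.mul_omega0_dvd (by simp) (Ordinal.natCast_lt_omega0 2)
    (Ordinal.isSuccPrelimit_iff_omega0_dvd.1 h.isSuccPrelimit)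

theorem isSuccLimit_two_mul {θ : Ordinal.{u}} (h : Order.IsSuccLimit θ) :
    Order.IsSuccLimit (2 * θ) := by
  rwa [two_mul_eq_self_of_isSuccLimit h]

theorem two_mul_omega0_opow {μ : Ordinal.{u}} (h : 1 ≤ μ) : 2 * ω ^ μ = ω ^ μ :=
  Ordinal.mul_omega0_dvd (by simp) (Ordinal.natCast_lt_omega0 2)
    (by simpa using Ordinal.opow_dvd_opow ω h)

theorem isSuccLimit_omega0_opow {μ : Ordinal.{u}} (h : 1 ≤ μ) : Order.IsSuccLimit (ω ^ μ) :=
  Ordinal.isSuccLimit_opow_left Ordinal.isSuccLimit_omega0 (zero_lt_one.trans_le h).ne'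

theorem omega0_opow_lt_omega_one {μ : Ordinal.{0}} (h : μ < ω₁) : ω ^ μ < ω₁ := by
  rw [← Cardinal.ord_aleph, Cardinal.lt_ord] at *
  refine (Ordinal.card_opow_le _ _).trans_lt ?_
  simp [h]

theorem two_mul_add_one_ne (a b : Ordinal.{u}) : 2 * a + 1 ≠ 2 * b := by
  intro h
  have h1 := congrArg (· % 2) h
  simp only [Ordinal.mul_add_mod_self, Ordinal.mul_mod] at h1
  rw [Ordinal.mod_eq_of_lt one_lt_two] at h1
  exact one_ne_zero h1

theorem exists_eq_two_mul_or (ζ : Ordinal.{u}) : ∃ ν, ζ = 2 * ν ∨ ζ = 2 * ν + 1 := by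
  refine ⟨ζ / 2, ?_⟩
  have h1 : ζ % 2 < Order.succ 1 := by
    rw [Order.succ_eq_add_one, one_add_one_eq_two]
    exact Ordinal.mod_lt ζ two_ne_zero
  rcases (Order.lt_succ_iff.1 h1).eq_or_lt with h | h
  · right
    conv_lhs => rw [← Ordinal.div_add_mod ζ 2, h]
  · left
    rw [Order.lt_one_iff] at h
    conv_lhs => rw [← Ordinal.div_add_mod ζ 2, h, add_zero]

/-- Since `2 * ω = ω`, left multiplication by two absorbs the limit part, so even ordinals can be
indexed by all ordinals. -/
theorem evenOrd_iff {ζ : Ordinal.{0}} : EvenOrd ζ ↔ ∃ ν, ζ = 2 * ν := by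
  have h2 : (2 : Ordinal.{0}) * ω = ω := Ordinal.natCast_mul_omega0 (n := 2) (by norm_num)
  constructor
  · rintro ⟨μ, n, rfl⟩
    refine ⟨ω * μ + n, ?_⟩
    rw [mul_add, ← mul_assoc, h2]
    push_cast
    rfl
  · rintro ⟨ν, rfl⟩
    obtain ⟨n, hn⟩ := Ordinal.lt_omega0.1 (Ordinal.mod_lt ν Ordinal.omega0_ne_zero)
    refine ⟨ν / ω, n, ?_⟩
    conv_lhs => rw [← Ordinal.div_add_mod ν ω, hn, mul_add, ← mul_assoc, h2]
    push_cast
    rfl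

theorem evenOrd_two_mul (ν : Ordinal.{0}) : EvenOrd (2 * ν) := evenOrd_iff.2 ⟨ν, rfl⟩

theorem not_evenOrd_two_mul_add_one (ν : Ordinal.{0}) : ¬ EvenOrd (2 * ν + 1) := fun h => by
  obtain ⟨ν', h⟩ := evenOrd_iff.1 h
  exact two_mul_add_one_ne _ _ h

end OrdinalArithmetic

/-! ### Rank functions with local control on levels. -/

section LevelRank

variable {X : Type*}

/-- The transfinite difference `⋃ {F_η \ F_{η+1} : η < l even}`. -/
def transDiff (l : Ordinal.{0}) (F : Ordinal.{0} → Set X) : Set X :=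
  ⋃ η ∈ {η | η < l ∧ EvenOrd η}, F η \ F (η + 1)

theorem mem_transDiff {l : Ordinal.{0}} {F : Ordinal.{0} → Set X} {x : X} :
    x ∈ transDiff l F ↔ ∃ η, (η < l ∧ EvenOrd η) ∧ x ∈ F η ∧ x ∉ F (η + 1) := by
  simp only [transDiff, mem_iUnion, exists_prop, Set.mem_sdiff, mem_ofPred_eq]

variable [TopologicalSpace X]

/-- There is an upper semicontinuous ordinal-valued function `ρ < κ` on `s` such that any `y` close
to `x` at the same level of `ρ` satisfies `R x y`. -/
def LevelRank (s : Set X) (κ : Ordinal.{0}) (R : X → X → Prop) : Prop :=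
  ∃ ρ : X → Ordinal.{0}, ∀ x ∈ s, ρ x < κ ∧
    ∀ᶠ y in 𝓝[s] x, ρ y ≤ ρ x ∧ (ρ y = ρ x → R x y)

theorem LevelRank.mono {s : Set X} {κ κ' : Ordinal.{0}} {R R' : X → X → Prop}
    (h : LevelRank s κ R) (hκ : κ ≤ κ') (hR : ∀ x ∈ s, ∀ y ∈ s, R x y → R' x y) :
    LevelRank s κ' R' := by
  obtain ⟨ρ, hρ⟩ := h
  refine ⟨ρ, fun x hx => ⟨(hρ x hx).1.trans_le hκ, ?_⟩⟩
  filter_upwards [(hρ x hx).2, self_mem_nhdsWithin] with y hy hys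
  exact ⟨hy.1, fun h => hR x hx y hys (hy.2 h)⟩

theorem LevelRank.subset {s t : Set X} {κ : Ordinal.{0}} {R : X → X → Prop}
    (h : LevelRank s κ R) (hts : t ⊆ s) : LevelRank t κ R := by
  obtain ⟨ρ, hρ⟩ := h
  exact ⟨ρ, fun x hx => ⟨(hρ x (hts hx)).1, nhdsWithin_mono x hts (hρ x (hts hx)).2⟩⟩

theorem LevelRank.and {s : Set X} {μ : Ordinal.{0}} {R R' : X → X → Prop}
    (h : LevelRank s (ω ^ μ) R) (h' : LevelRank s (ω ^ μ) R') :
    LevelRank s (ω ^ μ) (fun x y => R x y ∧ R' x y) := by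
  obtain ⟨ρ, hρ⟩ := h
  obtain ⟨ρ', hρ'⟩ := h'
  refine ⟨fun x => natSum (ρ x) (ρ' x), fun x hx =>
    ⟨natSum_lt_omega0_opow μ _ (hρ x hx).1 _ (hρ' x hx).1, ?_⟩⟩
  filter_upwards [(hρ x hx).2, (hρ' x hx).2] with y hy hy'
  refine ⟨natSum_mono hy.1 hy'.1, fun h => ?_⟩
  obtain ⟨h1, h2⟩ := eq_and_eq_of_natSum_eq hy.1 hy'.1 h
  exact ⟨hy.2 h1, hy'.2 h2⟩

theorem LevelRank.of_forall {s : Set X} {κ : Ordinal.{0}} {R : X → X → Prop} (hκ : 0 < κ)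
    (h : ∀ x ∈ s, ∀ y ∈ s, R x y) : LevelRank s κ R := by
  refine ⟨fun _ => 0, fun x hx => ⟨hκ, ?_⟩⟩
  filter_upwards [self_mem_nhdsWithin] with y hy
  exact ⟨le_rfl, fun _ => h x hx y hy⟩

theorem LevelRank.forall_finset {ι : Type*} {s : Set X} {μ : Ordinal.{0}}
    {R : ι → X → X → Prop} (t : Finset ι) (h : ∀ i ∈ t, LevelRank s (ω ^ μ) (R i)) :
    LevelRank s (ω ^ μ) (fun x y => ∀ i ∈ t, R i x y) := by
  classical
  induction t using Finset.induction_on with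
  | empty => exact .of_forall (Ordinal.opow_pos _ Ordinal.omega0_pos) (by simp)
  | insert i t _ ih =>
    refine ((h i (by simp)).and (ih fun j hj => h j (by simp [hj]))).mono le_rfl ?_
    intro x _ y _ hxy
    simpa using hxy

/-- Level ranks can be glued from local ones, by taking the minimum of the local rank functions. -/
theorem LevelRank.of_local {s : Set X} {κ : Ordinal.{0}} {R : X → X → Prop}
    (h : ∀ x ∈ s, ∃ U, IsOpen U ∧ x ∈ U ∧ LevelRank (s ∩ U) κ R) : LevelRank s κ R := by
  let V (x : X) : Set Ordinal.{0} := {a | ∃ (U : Set X) (ρ : X → Ordinal.{0}), IsOpen U ∧ x ∈ U ∧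
    (∀ x ∈ s ∩ U, ρ x < κ ∧ ∀ᶠ y in 𝓝[s ∩ U] x, ρ y ≤ ρ x ∧ (ρ y = ρ x → R x y)) ∧ a = ρ x}
  refine ⟨fun x => sInf (V x), fun x hx => ?_⟩
  have hne : (V x).Nonempty := by
    obtain ⟨U, hU, hxU, ρ, hρ⟩ := h x hx
    exact ⟨ρ x, U, ρ, hU, hxU, hρ, rfl⟩
  obtain ⟨U, ρ, hU, hxU, hρ, hV⟩ := csInf_mem hne
  have hV : sInf (V x) = ρ x := hV
  obtain ⟨hlt, hev⟩ := hρ x ⟨hx, hxU⟩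
  rw [nhdsWithin_inter_of_mem' (mem_nhdsWithin_of_mem_nhds (hU.mem_nhds hxU))] at hev
  refine ⟨hV.trans_lt hlt, ?_⟩
  filter_upwards [hev, mem_nhdsWithin_of_mem_nhds (hU.mem_nhds hxU)] with y hy hyU
  have h1 : sInf (V y) ≤ ρ y := csInf_le' ⟨U, ρ, hU, hyU, hρ, rfl⟩
  -- If the minima at `x` and `y` agree, the chain `sInf (V y) ≤ ρ y ≤ ρ x` collapses, so the rank
  -- attaining the minimum at `x` is constant there.
  refine ⟨(h1.trans hy.1).trans hV.ge, fun h2 => hy.2 (le_antisymm hy.1 ?_)⟩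
  rw [← hV, ← h2]
  exact h1

/-- Level ranks on the levels of an upper semicontinuous function with values in `ℕ` combine
lexicographically. -/
theorem LevelRank.of_nat_levels {κ : Ordinal.{0}} {R : X → X → Prop} (σ : X → ℕ)
    (hσ : ∀ x, ∀ᶠ y in 𝓝 x, σ y ≤ σ x) (h : ∀ k, LevelRank {x | σ x = k} κ R) :
    LevelRank univ (κ * ω) R := by
  choose ρ hρ using h
  refine ⟨fun x => κ * (σ x : ℕ) + ρ (σ x) x, fun x _ => ?_⟩
  obtain ⟨hlt, hev⟩ := hρ (σ x) x rfl
  constructor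
  · refine (mul_natCast_add_lt hlt (Nat.lt_succ_self _)).trans_le ?_
    gcongr
    exact (Ordinal.natCast_lt_omega0 _).le
  rw [nhdsWithin_univ]
  filter_upwards [hσ x, eventually_nhdsWithin_iff.1 hev] with y hy hy'
  rcases hy.eq_or_lt with heq | hlt'
  · obtain ⟨h1, h2⟩ := hy' heq
    rw [heq]
    exact ⟨by gcongr, fun h3 => h2 ((add_right_inj _).1 h3)⟩
  · have h1 : κ * (σ y : ℕ) + ρ (σ y) y < κ * (σ x : ℕ) + ρ (σ x) x :=
      (mul_natCast_add_lt (hρ (σ y) y rfl).1 hlt').trans_le le_self_add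
    exact ⟨h1.le, fun h2 => absurd h2 h1.ne⟩

/-! ### Passing between closed sequences and rank functions. -/

theorem IsClosedSeq.antitone {l : Ordinal.{0}} {F : Ordinal.{0} → Set X} (hF : IsClosedSeq l F)
    {η ζ : Ordinal.{0}} (h : η ≤ ζ) : F ζ ⊆ F η := by
  rcases lt_or_ge ζ l with h' | h'
  · exact hF.decreasing η ζ h h'
  · rw [hF.eq_empty ζ h']
    exact empty_subset _

theorem IsClosedSeq.isClosed' {l : Ordinal.{0}} {F : Ordinal.{0} → Set X} (hF : IsClosedSeq l F)
    (η : Ordinal.{0}) : IsClosed (F η) := by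
  rcases lt_or_ge η l with h' | h'
  · exact hF.isClosed η h'
  · rw [hF.eq_empty η h']
    exact isClosed_empty

/-- Every point leaves a continuous decreasing sequence of closed sets at a successor step. -/
theorem IsClosedSeq.exists_last {l : Ordinal.{0}} {F : Ordinal.{0} → Set X}
    (hF : IsClosedSeq l F) (x : X) : ∃ η < l, x ∈ F η ∧ x ∉ F (η + 1) := by
  have hne : {η | x ∉ F η}.Nonempty := ⟨l, by simp [hF.eq_empty l le_rfl]⟩
  have hmem : x ∉ F (sInf {η | x ∉ F η}) := csInf_mem hne
  have hmin : ∀ η < sInf {η | x ∉ F η}, x ∈ F η := fun η hη => by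
    by_contra hx
    exact notMem_of_lt_csInf' hη hx
  have hle : sInf {η | x ∉ F η} ≤ l := csInf_le' (by simp [hF.eq_empty l le_rfl])
  generalize sInf {η | x ∉ F η} = τ at *
  rcases Ordinal.zero_or_succ_or_isSuccLimit τ with rfl | ⟨η, rfl⟩ | hτ
  · rw [hF.zero] at hmem
    exact absurd (mem_univ x) hmem
  · exact ⟨η, (Order.lt_succ η).trans_le hle, hmin η (Order.lt_succ η), hmem⟩
  · have h1 : x ∈ ⋂ η < τ, F η := by simpa using hmin
    rcases hle.eq_or_lt with rfl | hlt
    · rw [hF.inter_eq_empty hτ] at h1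
      exact absurd h1 (notMem_empty x)
    · rw [← hF.continuous τ hlt hτ] at h1
      exact absurd h1 hmem

theorem IsClosedSeq.mem_transDiff_iff {l : Ordinal.{0}} {F : Ordinal.{0} → Set X}
    (hF : IsClosedSeq l F) {x : X} {η : Ordinal.{0}} (hη : x ∈ F η) (hη' : x ∉ F (η + 1)) :
    x ∈ transDiff l F ↔ EvenOrd η := by
  rw [mem_transDiff]
  constructor
  · rintro ⟨ζ, ⟨-, hζ⟩, h1, h2⟩
    have h3 : ζ = η := by
      refine le_antisymm ?_ ?_ <;> by_contra! h
      · exact hη' (hF.antitone (Order.add_one_le_of_lt h) h1)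
      · exact h2 (hF.antitone (Order.add_one_le_of_lt h) hη)
    exact h3 ▸ hζ
  · refine fun h => ⟨η, ⟨?_, h⟩, hη, hη'⟩
    by_contra! h1
    rw [hF.eq_empty η h1] at hη
    exact hη

/-- The rank of a point is the last index whose set contains it. The complement of the next closed
set is a neighbourhood where the rank cannot grow, and its parity decides membership in the
difference. -/
theorem IsClosedSeq.levelRank {l : Ordinal.{0}} {F : Ordinal.{0} → Set X}
    (hF : IsClosedSeq l F) :
    LevelRank univ l (fun x y => x ∈ transDiff l F ↔ y ∈ transDiff l F) := by
  choose ρ hρ hmem hnot using hF.exists_last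
  refine ⟨ρ, fun x _ => ⟨hρ x, ?_⟩⟩
  rw [nhdsWithin_univ]
  filter_upwards [(hF.isClosed' (ρ x + 1)).isOpen_compl.mem_nhds (hnot x)] with y hy
  constructor
  · by_contra! h
    exact hy (hF.antitone (Order.add_one_le_of_lt h) (hmem y))
  · intro h
    rw [hF.mem_transDiff_iff (hmem x) (hnot x), hF.mem_transDiff_iff (hmem y) (hnot y), h]

/-- On the level `ρ = a` the even set is the superlevel set, and the following odd set removes the
closure of the part of `B` of rank at least `a`. A point of `A` at this level is not in that
closure: nearby points of rank at least `a` have rank exactly `a`, hence avoid `B`. -/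
theorem LevelRank.exists_isClosedSeq {μ : Ordinal.{0}} (h1 : 1 ≤ μ) (hμ : μ < ω₁) {A B : Set X}
    (h : LevelRank univ (ω ^ μ) (fun x y => x ∈ A → y ∉ B)) :
    ∃ F : Ordinal.{0} → Set X, IsClosedSeq (ω ^ μ) F ∧
      A ⊆ transDiff (ω ^ μ) F ∧ transDiff (ω ^ μ) F ⊆ Bᶜ := by
  obtain ⟨ρ, hρ⟩ := h
  simp only [nhdsWithin_univ, mem_univ, forall_const] at hρ
  have hcl : ∀ η, IsClosed {x | η ≤ ρ x} := fun η => by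
    rw [← isOpen_compl_iff, isOpen_iff_mem_nhds]
    intro x hx
    filter_upwards [(hρ x).2] with y hy
    simp only [mem_compl_iff, mem_ofPred_eq, not_le] at hx ⊢
    exact hy.1.trans_lt hx
  have h2 : ∀ a : Ordinal.{0}, 2 * a + 1 < 2 * (a + 1) := fun a => by
    rw [mul_add, mul_one]
    gcongr
    exact one_lt_two
  have hdiv : ∀ a : Ordinal.{0}, (2 * a + 1) / 2 = a := fun a => by
    rw [Ordinal.mul_add_div _ two_ne_zero, Ordinal.div_eq_zero_of_lt one_lt_two, add_zero]
  classical
  let F (ζ : Ordinal.{0}) : Set X := if EvenOrd ζ then {x | ζ / 2 ≤ ρ x} else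
    {x | ζ / 2 + 1 ≤ ρ x} ∪ closure (B ∩ {x | ζ / 2 ≤ ρ x})
  have hFe : ∀ a, F (2 * a) = {x | a ≤ ρ x} := fun a => by
    simp only [F, if_pos (evenOrd_two_mul a), Ordinal.mul_div_cancel a two_ne_zero]
  have hFo : ∀ a, F (2 * a + 1) = {x | a + 1 ≤ ρ x} ∪ closure (B ∩ {x | a ≤ ρ x}) := fun a => by
    simp only [F, if_neg (not_evenOrd_two_mul_add_one a), hdiv]
  have hup : ∀ ζ, F ζ ⊆ {x | ζ / 2 ≤ ρ x} := fun ζ => by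
    obtain ⟨a, rfl | rfl⟩ := exists_eq_two_mul_or ζ
    · rw [hFe, Ordinal.mul_div_cancel a two_ne_zero]
    · rw [hFo, hdiv]
      refine union_subset (fun x hx => (Order.le_succ a).trans hx) ?_
      exact closure_minimal inter_subset_right (hcl a)
  have hlow : ∀ ζ, {x | ζ / 2 + 1 ≤ ρ x} ⊆ F ζ := fun ζ => by
    obtain ⟨a, rfl | rfl⟩ := exists_eq_two_mul_or ζ
    · rw [hFe, Ordinal.mul_div_cancel a two_ne_zero]
      exact fun x hx => (Order.le_succ a).trans hx
    · rw [hFo, hdiv]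
      exact subset_union_left
  have hanti : ∀ η ζ, η ≤ ζ → F ζ ⊆ F η := fun η ζ h => by
    -- Indices with different halves are separated by a superlevel set of `ρ` (`hup`, `hlow`); with
    -- equal halves only one even-odd pair is left.
    rcases (Ordinal.div_le_left h 2).eq_or_lt with heq | hlt
    · obtain ⟨a, rfl | rfl⟩ := exists_eq_two_mul_or η
      · refine (hup ζ).trans ?_
        rw [← heq, Ordinal.mul_div_cancel a two_ne_zero, hFe]
      · obtain ⟨b, rfl | rfl⟩ := exists_eq_two_mul_or ζ
        · rw [hdiv, Ordinal.mul_div_cancel b two_ne_zero] at heq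
          subst heq
          exact absurd h (not_le.2 (Order.lt_add_one_iff.2 le_rfl))
        · rw [hdiv, hdiv] at heq
          rw [heq]
    · exact (hup ζ).trans (subset_trans (fun x hx => (Order.add_one_le_of_lt hlt).trans hx)
        (hlow η))
  have hlim : Order.IsSuccLimit (ω ^ μ) := isSuccLimit_omega0_opow h1
  have hcont : ∀ θ, Order.IsSuccLimit θ → F θ = ⋂ η < θ, F η := fun θ hθ => by
    refine subset_antisymm (subset_iInter₂ fun η hη => hanti η θ hη.le) fun x hx => ?_
    rw [← two_mul_eq_self_of_isSuccLimit hθ, hFe]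
    change θ ≤ ρ x
    refine le_of_forall_lt fun η hη => ?_
    have h3 : 2 * (η + 1) < θ := by
      rw [← two_mul_eq_self_of_isSuccLimit hθ]
      gcongr
      exact hθ.add_one_lt hη
    have h4 := mem_iInter₂.1 hx _ h3
    rw [hFe] at h4
    exact Order.add_one_le_iff.1 h4
  have hempty : ∀ η, ω ^ μ ≤ η → F η = ∅ := fun η hη => by
    refine eq_empty_of_forall_notMem fun x hx => ?_
    have h3 := hanti _ _ hη hx
    rw [← two_mul_omega0_opow h1, hFe] at h3
    exact absurd (hρ x).1 (not_lt.2 h3)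
  refine ⟨F, ⟨omega0_opow_lt_omega_one hμ, fun η _ => ?_, fun η ζ h _ => hanti η ζ h,
    fun θ _ => hcont θ, ?_, fun _ => ?_, hempty⟩, fun x hx => ?_, fun x hx => ?_⟩
  · obtain ⟨a, rfl | rfl⟩ := exists_eq_two_mul_or η
    · exact hFe a ▸ hcl a
    · exact hFo a ▸ (hcl _).union isClosed_closure
  · have := hFe 0
    rw [mul_zero] at this
    simp [this]
  · rw [← hcont _ hlim, hempty _ le_rfl]
  · refine mem_transDiff.2 ⟨2 * ρ x, ⟨?_, evenOrd_two_mul _⟩, ?_, ?_⟩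
    · rw [← two_mul_omega0_opow h1]
      have := (hρ x).1
      gcongr
    · rw [hFe]
      exact le_rfl (a := ρ x)
    · rw [hFo]
      rintro (h3 | h3)
      · exact absurd (Order.add_one_le_iff.1 (show ρ x + 1 ≤ ρ x from h3)) (lt_irrefl _)
      · obtain ⟨y, ⟨hyB, hle⟩, hy⟩ := ((mem_closure_iff_frequently.1 h3).and_eventually
          (hρ x).2).exists
        exact hy.2 (le_antisymm hy.1 hle) hx hyB
  · obtain ⟨η, ⟨-, hη⟩, h3, h4⟩ := mem_transDiff.1 hx
    obtain ⟨a, rfl⟩ := evenOrd_iff.1 hη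
    rw [hFe] at h3
    rw [hFo] at h4
    exact fun hB => h4 (Or.inr (subset_closure ⟨hB, h3⟩))

end LevelRank

/-! ### Alternating sums of decreasing sequences. -/

section AltSum

variable {X : Type*}

theorem altSum_zero (f : Ordinal.{0} → X → ℝ) (x : X) : altSum f 0 x = 0 := by
  rw [altSum, Ordinal.limitRecOn_zero]

theorem altSum_add_one (f : Ordinal.{0} → X → ℝ) (θ : Ordinal.{0}) (x : X) :
    altSum f (θ + 1) x = altSum f θ x + ordSign θ * f θ x := by
  rw [altSum, Ordinal.limitRecOn_add_one]
  rfl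

theorem altSum_of_isSuccLimit (f : Ordinal.{0} → X → ℝ) {θ : Ordinal.{0}}
    (h : Order.IsSuccLimit θ) (x : X) :
    altSum f θ x = sSup {r : ℝ | ∃ ζ < θ, EvenOrd ζ ∧ r = altSum f ζ x} := by
  rw [altSum, Ordinal.limitRecOn_limit _ _ _ _ h]
  simp only [altSum, exists_prop]

theorem altSum_congr {f g : Ordinal.{0} → X → ℝ} {θ : Ordinal.{0}} {x : X}
    (h : ∀ η < θ, f η x = g η x) : altSum f θ x = altSum g θ x := by
  induction θ using Ordinal.limitRecOn with
  | zero => simp [altSum_zero]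
  | add_one θ ih =>
    rw [altSum_add_one, altSum_add_one, h θ (Order.lt_add_one_iff.2 le_rfl),
      ih fun η hη => h η (hη.trans (Order.lt_add_one_iff.2 le_rfl))]
  | limit θ hθ ih =>
    rw [altSum_of_isSuccLimit f hθ, altSum_of_isSuccLimit g hθ]
    congr 1
    ext r
    refine exists_congr fun ζ => and_congr_right fun hζ => ?_
    rw [ih ζ hζ fun η hη => h η (hη.trans hζ)]

theorem ordSign_two_mul (ν : Ordinal.{0}) : ordSign (2 * ν) = 1 :=
  if_pos (evenOrd_two_mul ν)

theorem ordSign_two_mul_add_one (ν : Ordinal.{0}) : ordSign (2 * ν + 1) = -1 :=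
  if_neg (not_evenOrd_two_mul_add_one ν)

theorem altSum_two_mul_add_one (f : Ordinal.{0} → X → ℝ) (ν : Ordinal.{0}) (x : X) :
    altSum f (2 * (ν + 1)) x = altSum f (2 * ν) x + (f (2 * ν) x - f (2 * ν + 1) x) := by
  rw [mul_add, mul_one, ← one_add_one_eq_two, ← add_assoc, one_add_one_eq_two, altSum_add_one,
    altSum_add_one, ordSign_two_mul, ordSign_two_mul_add_one]
  ring

theorem altSum_two_mul_of_isSuccLimit (f : Ordinal.{0} → X → ℝ) {ν : Ordinal.{0}}
    (h : Order.IsSuccLimit ν) (x : X) :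
    altSum f (2 * ν) x = sSup (range fun a : Iio ν => altSum f (2 * a.1) x) := by
  rw [altSum_of_isSuccLimit f (isSuccLimit_two_mul h)]
  congr 1
  ext r
  constructor
  · rintro ⟨ζ, hζ, he, rfl⟩
    obtain ⟨a, rfl⟩ := evenOrd_iff.1 he
    exact ⟨⟨a, (mul_lt_mul_iff_right₀ two_pos).1 hζ⟩, rfl⟩
  · rintro ⟨⟨a, ha⟩, rfl⟩
    exact ⟨2 * a, (mul_lt_mul_iff_right₀ two_pos).2 ha, evenOrd_two_mul a, rfl⟩

section Antitone

variable {g : Ordinal.{0} → X → ℝ}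

/-- The transfinite Leibniz criterion: even partial sums increase, and they decrease once the next
term is added. The claims need one joint induction, because at a limit the real `sSup` is meaningful
only when the earlier bounds make the set bounded. -/
theorem isLUB_altSum_and_bounds (hg : Antitone g) (h0 : ∀ η, 0 ≤ g η) (x : X) (ν' : Ordinal.{0}) :
    (Order.IsSuccLimit ν' →
      IsLUB (range fun a : Iio ν' => altSum g (2 * a.1) x) (altSum g (2 * ν') x)) ∧
    ∀ ν ≤ ν', altSum g (2 * ν) x ≤ altSum g (2 * ν') x ∧
      altSum g (2 * ν') x + g (2 * ν') x ≤ altSum g (2 * ν) x + g (2 * ν) x := by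
  induction ν' using Ordinal.limitRecOn with
  | zero =>
    refine ⟨fun h => absurd rfl h.ne_bot, fun ν hν => ?_⟩
    obtain rfl : ν = 0 := le_antisymm hν zero_le
    exact ⟨le_rfl, le_rfl⟩
  | add_one ν' ih =>
    refine ⟨fun h => absurd h (Order.not_isSuccLimit_succ ν'), fun ν hν => ?_⟩
    rcases hν.eq_or_lt with rfl | hlt
    · exact ⟨le_rfl, le_rfl⟩
    obtain ⟨h1, h2⟩ := ih.2 ν (Order.lt_add_one_iff.1 hlt)
    have h3 : g (2 * ν' + 1) x ≤ g (2 * ν') x := hg (Order.le_succ _) x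
    have h4 : g (2 * (ν' + 1)) x ≤ g (2 * ν' + 1) x := by
      refine hg ?_ x
      rw [mul_add, mul_one]
      gcongr
      exact one_le_two
    rw [altSum_two_mul_add_one]
    constructor <;> linarith
  | limit ν' hν' ih =>
    have hlub : IsLUB (range fun a : Iio ν' => altSum g (2 * a.1) x) (altSum g (2 * ν') x) := by
      rw [altSum_two_mul_of_isSuccLimit g hν']
      refine isLUB_csSup ⟨_, ⟨0, hν'.bot_lt⟩, rfl⟩ ⟨g 0 x, ?_⟩
      rintro _ ⟨⟨a, ha⟩, rfl⟩
      have h1 := ((ih a ha).2 0 zero_le).2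
      have h2 := h0 (2 * a) x
      simp only [mul_zero, altSum_zero, Pi.zero_apply] at h1 h2 ⊢
      linarith
    refine ⟨fun _ => hlub, fun ν hν => ?_⟩
    rcases hν.eq_or_lt with rfl | hlt
    · exact ⟨le_rfl, le_rfl⟩
    refine ⟨hlub.1 ⟨⟨ν, hlt⟩, rfl⟩, le_sub_iff_add_le.1 (hlub.2 ?_)⟩
    rintro _ ⟨⟨a, ha⟩, rfl⟩
    have ha' : a < ν' := ha
    have h3 : g (2 * ν') x ≤ g (2 * a) x := hg (by gcongr) x
    have h4 : g (2 * ν') x ≤ g (2 * ν) x := hg (by gcongr) x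
    dsimp only
    rcases le_total a ν with h | h
    · linarith [((ih ν hlt).2 a h).1]
    · linarith [((ih a ha).2 ν h).2]

theorem isLUB_altSum (hg : Antitone g) (h0 : ∀ η, 0 ≤ g η) (x : X) {ν : Ordinal.{0}}
    (hν : Order.IsSuccLimit ν) :
    IsLUB (range fun a : Iio ν => altSum g (2 * a.1) x) (altSum g (2 * ν) x) :=
  (isLUB_altSum_and_bounds hg h0 x ν).1 hν

theorem altSum_mono (hg : Antitone g) (h0 : ∀ η, 0 ≤ g η) (x : X) :
    Monotone fun ν => altSum g (2 * ν) x :=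
  fun ν ν' h => ((isLUB_altSum_and_bounds hg h0 x ν').2 ν h).1

theorem altSum_add_antitone (hg : Antitone g) (h0 : ∀ η, 0 ≤ g η) (x : X) :
    Antitone fun ν => altSum g (2 * ν) x + g (2 * ν) x :=
  fun ν ν' h => ((isLUB_altSum_and_bounds hg h0 x ν').2 ν h).2

theorem altSum_nonneg (hg : Antitone g) (h0 : ∀ η, 0 ≤ g η) (x : X) (ν : Ordinal.{0}) :
    0 ≤ altSum g (2 * ν) x := by
  simpa [altSum_zero] using altSum_mono hg h0 x (zero_le (a := ν))

theorem altSum_le (hg : Antitone g) (h0 : ∀ η, 0 ≤ g η) (x : X) (ν : Ordinal.{0}) :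
    altSum g (2 * ν) x ≤ g 0 x := by
  have h1 := altSum_add_antitone hg h0 x (zero_le (a := ν))
  have h2 := h0 (2 * ν) x
  simp only [mul_zero, altSum_zero, Pi.zero_apply] at h1 h2
  linarith

/-- The tail of an alternating sum is bounded by the total decrease of the terms. -/
theorem altSum_sub_le (hg : Antitone g) (h0 : ∀ η, 0 ≤ g η) (x : X) {ν ν' : Ordinal.{0}}
    (hν' : Order.IsSuccLimit ν') (h : ν < ν') {m : ℝ} (hm : ∀ a < ν', m ≤ g (2 * a) x) :
    altSum g (2 * ν') x - altSum g (2 * ν) x ≤ g (2 * ν) x - m := by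
  refine sub_le_iff_le_add.2 ((isLUB_altSum hg h0 x hν').2 ?_)
  rintro _ ⟨⟨a, ha⟩, rfl⟩
  dsimp only
  rcases le_total a ν with h1 | h1
  · linarith [altSum_mono hg h0 x h1, hm ν h]
  · linarith [altSum_add_antitone hg h0 x h1, hm a ha]

/-- An even initial block can be split off without disturbing signs; this permits cutting a sum into
blocks of length `ω ^ μ`. -/
theorem altSum_two_mul_add (hg : Antitone g) (h0 : ∀ η, 0 ≤ g η) (x : X) (a b : Ordinal.{0}) :
    altSum g (2 * (a + b)) x =
      altSum g (2 * a) x + altSum (fun η => g (2 * a + η)) (2 * b) x := by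
  have hg' : Antitone fun η => g (2 * a + η) := fun η ζ h => hg (by gcongr)
  induction b using Ordinal.limitRecOn with
  | zero => simp [altSum_zero]
  | add_one b ih =>
    rw [← add_assoc, altSum_two_mul_add_one, ih, altSum_two_mul_add_one]
    simp only [mul_add, ← add_assoc]
  | limit b hb ih =>
    have hab : Order.IsSuccLimit (a + b) := Ordinal.isSuccLimit_add a hb
    refine (isLUB_altSum hg h0 x hab).unique ⟨?_, fun u hu => ?_⟩
    · rintro _ ⟨⟨c, hc⟩, rfl⟩
      obtain ⟨b', hb', hc'⟩ := (Ordinal.lt_add_iff_of_isSuccLimit hb).1 hc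
      refine (altSum_mono hg h0 x hc'.le).trans ?_
      dsimp only
      rw [ih b' hb']
      gcongr
      exact altSum_mono hg' (fun η => h0 _) x hb'.le
    · rw [← le_sub_iff_add_le']
      refine (isLUB_altSum hg' (fun η => h0 _) x hb).2 ?_
      rintro _ ⟨⟨b', hb'⟩, rfl⟩
      have hb'' : b' < b := hb'
      dsimp only
      rw [le_sub_iff_add_le', ← ih b' hb']
      exact hu ⟨⟨a + b', by simpa using hb''⟩, rfl⟩

end Antitone

/-- Limits of even partial sums are monotone limits, so dominated convergence with majorant `c`
exchanges them with the series. -/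
theorem altSum_tsum {c : ℕ → ℝ} (hc : Summable c) (hc0 : ∀ n, 0 ≤ c n)
    {G : ℕ → Ordinal.{0} → X → ℝ} (hG : ∀ n, Antitone (G n)) (h0 : ∀ n η, 0 ≤ G n η)
    (h1 : ∀ n x, G n 0 x ≤ 1) (ν : Ordinal.{0}) (x : X) :
    altSum (fun η x => ∑' n, c n * G n η x) (2 * ν) x =
      ∑' n, c n * altSum (G n) (2 * ν) x := by
  have hsum : ∀ η x, Summable fun n => c n * G n η x := fun η x =>
    hc.of_nonneg_of_le (fun n => mul_nonneg (hc0 n) (h0 n η x)) fun n =>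
      mul_le_of_le_one_right (hc0 n) ((hG n zero_le x).trans (h1 n x))
  have hbd : ∀ n ν, altSum (G n) (2 * ν) x ≤ 1 := fun n ν =>
    (altSum_le (hG n) (h0 n) x ν).trans (h1 n x)
  have hsumT : ∀ ν, Summable fun n => c n * altSum (G n) (2 * ν) x := fun ν =>
    hc.of_nonneg_of_le (fun n => mul_nonneg (hc0 n) (altSum_nonneg (hG n) (h0 n) x ν)) fun n =>
      mul_le_of_le_one_right (hc0 n) (hbd n ν)
  have hg : Antitone fun η x => ∑' n, c n * G n η x := fun η ζ h x =>
    (hsum ζ x).tsum_le_tsum (fun n => mul_le_mul_of_nonneg_left (hG n h x) (hc0 n)) (hsum η x)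
  have hg0 : ∀ η, 0 ≤ fun x => ∑' n, c n * G n η x := fun η x =>
    tsum_nonneg fun n => mul_nonneg (hc0 n) (h0 n η x)
  induction ν using Ordinal.limitRecOn with
  | zero => simp [altSum_zero]
  | add_one ν ih =>
    rw [altSum_two_mul_add_one, ih, ← (hsum _ x).tsum_sub (hsum _ x),
      ← (hsumT ν).tsum_add ((hsum _ x).sub (hsum _ x))]
    refine tsum_congr fun n => ?_
    rw [altSum_two_mul_add_one]
    ring
  | limit ν hν ih =>
    have hne : Nonempty (Iio ν) := ⟨⟨0, hν.bot_lt⟩⟩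
    have ht : Tendsto (fun a : Iio ν => ∑' n, c n * altSum (G n) (2 * a.1) x) atTop
        (𝓝 (∑' n, c n * altSum (G n) (2 * ν) x)) := by
      refine tendsto_tsum_of_dominated_convergence hc (fun n => ?_) (.of_forall fun a n => ?_)
      · have hm : Monotone fun a : Iio ν => altSum (G n) (2 * a.1) x :=
          fun a b h => altSum_mono (hG n) (h0 n) x h
        exact (tendsto_atTop_isLUB hm (isLUB_altSum (hG n) (h0 n) x hν)).const_mul _
      · have h2 := altSum_nonneg (hG n) (h0 n) x a.1
        rw [Real.norm_of_nonneg (mul_nonneg (hc0 n) h2)]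
        exact mul_le_of_le_one_right (hc0 n) (hbd n _)
    refine tendsto_nhds_unique ?_ ht
    have hm : Monotone fun a : Iio ν => altSum (fun η x => ∑' n, c n * G n η x) (2 * a.1) x :=
      fun a b h => altSum_mono hg hg0 x h
    refine (tendsto_atTop_isLUB hm (isLUB_altSum hg hg0 x hν)).congr fun a => ih a.1 a.2

theorem altSum_indicator {F : Ordinal.{0} → Set X} (hF : Antitone F) (ν : Ordinal.{0}) (x : X) :
    altSum (fun η => (F η).indicator 1) (2 * ν) x = (transDiff (2 * ν) F).indicator 1 x := by
  have hg : Antitone fun η => (F η).indicator (1 : X → ℝ) := fun η ζ h =>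
    indicator_le_indicator_of_subset (hF h) fun _ => zero_le_one
  have hg0 : ∀ η, 0 ≤ (F η).indicator (1 : X → ℝ) := fun η =>
    indicator_nonneg fun _ _ => zero_le_one
  have hmem : ∀ ν, x ∈ transDiff (2 * ν) F ↔ ∃ a < ν, x ∈ F (2 * a) ∧ x ∉ F (2 * a + 1) := by
    intro ν
    rw [mem_transDiff]
    constructor
    · rintro ⟨η, ⟨h, he⟩, h'⟩
      obtain ⟨a, rfl⟩ := evenOrd_iff.1 he
      exact ⟨a, (mul_lt_mul_iff_right₀ two_pos).1 h, h'⟩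
    · rintro ⟨a, h, h'⟩
      exact ⟨2 * a, ⟨(mul_lt_mul_iff_right₀ two_pos).2 h, evenOrd_two_mul a⟩, h'⟩
  induction ν using Ordinal.limitRecOn with
  | zero => simp [altSum_zero, transDiff]
  | add_one ν ih =>
    rw [altSum_two_mul_add_one, ih]
    have hsucc : x ∈ transDiff (2 * (ν + 1)) F ↔
        x ∈ transDiff (2 * ν) F ∨ (x ∈ F (2 * ν) ∧ x ∉ F (2 * ν + 1)) := by
      rw [hmem, hmem]
      constructor
      · rintro ⟨a, ha, h⟩
        rcases (Order.lt_add_one_iff.1 ha).eq_or_lt with rfl | ha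
        · exact Or.inr h
        · exact Or.inl ⟨a, ha, h⟩
      · rintro (⟨a, ha, h⟩ | h)
        · exact ⟨a, ha.trans (Order.lt_add_one_iff.2 le_rfl), h⟩
        · exact ⟨ν, Order.lt_add_one_iff.2 le_rfl, h⟩
    -- A point already counted has left the decreasing sets, so it is never counted twice.
    have hdisj : x ∈ transDiff (2 * ν) F → x ∉ F (2 * ν) := by
      rw [hmem]
      rintro ⟨a, ha, -, h⟩ h'
      refine h (hF ?_ h')
      refine Order.add_one_le_of_lt ?_
      gcongr
    have hsub : x ∈ F (2 * ν + 1) → x ∈ F (2 * ν) := fun h => hF (Order.le_succ _) h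
    clear hmem
    by_cases h1 : x ∈ transDiff (2 * ν) F <;> by_cases h2 : x ∈ F (2 * ν) <;>
      by_cases h3 : x ∈ F (2 * ν + 1) <;> simp_all
  | limit ν hν ih =>
    refine (isLUB_altSum hg hg0 x hν).unique ⟨?_, fun u hu => ?_⟩
    · rintro _ ⟨⟨a, ha⟩, rfl⟩
      have ha' : a < ν := ha
      dsimp only
      rw [ih a ha]
      refine indicator_le_indicator_apply_of_subset ?_ zero_le_one
      refine biUnion_mono (fun η hη => ⟨hη.1.trans ?_, hη.2⟩) fun _ _ => subset_rfl
      gcongr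
    · by_cases hx : x ∈ transDiff (2 * ν) F
      · obtain ⟨a, ha, h⟩ := (hmem ν).1 hx
        have h2 : a + 1 < ν := hν.add_one_lt ha
        have h3 := hu ⟨⟨a + 1, h2⟩, rfl⟩
        dsimp only at h3
        rw [ih _ h2, indicator_of_mem ((hmem _).2 ⟨a, Order.lt_add_one_iff.2 le_rfl, h⟩)] at h3
        rwa [indicator_of_mem hx]
      · rw [indicator_of_notMem hx]
        have h3 := hu ⟨⟨0, hν.bot_lt⟩, rfl⟩
        simpa [altSum_zero] using h3

end AltSum

/-! ### Oscillation rank and its stability. -/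

section OscRank

variable {X : Type*} [TopologicalSpace X]

/-- `f` has, for every `ε > 0`, oscillation at most `ε` locally on the levels of some rank function
with values below `ω ^ μ`. -/
def OscRank (μ : Ordinal.{0}) (f : X → ℝ) : Prop :=
  ∀ ε > 0, LevelRank univ (ω ^ μ) (fun x y => |f y - f x| ≤ ε)

theorem OscRank.mono {μ μ' : Ordinal.{0}} {f : X → ℝ} (h : OscRank μ f) (hμ : μ ≤ μ') :
    OscRank μ' f := fun ε hε =>
  (h ε hε).mono (Ordinal.opow_le_opow_right Ordinal.omega0_pos hμ) fun _ _ _ _ h => h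

theorem OscRank.const (μ : Ordinal.{0}) (c : ℝ) : OscRank μ (fun _ : X => c) := fun ε hε =>
  .of_forall (Ordinal.opow_pos _ Ordinal.omega0_pos) fun _ _ _ _ => by simpa using hε.le

theorem OscRank.add {μ : Ordinal.{0}} {f g : X → ℝ} (hf : OscRank μ f) (hg : OscRank μ g) :
    OscRank μ (fun x => f x + g x) := fun ε hε => by
  refine ((hf (ε / 2) (half_pos hε)).and (hg (ε / 2) (half_pos hε))).mono le_rfl ?_
  rintro x - y - ⟨h1, h2⟩
  calc |f y + g y - (f x + g x)| = |(f y - f x) + (g y - g x)| := by ring_nf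
    _ ≤ |f y - f x| + |g y - g x| := abs_add_le _ _
    _ ≤ ε := by linarith

theorem OscRank.neg {μ : Ordinal.{0}} {f : X → ℝ} (hf : OscRank μ f) :
    OscRank μ (fun x => -f x) := fun ε hε =>
  (hf ε hε).mono le_rfl fun x _ y _ h => by rwa [neg_sub_neg, abs_sub_comm]

theorem OscRank.sub {μ : Ordinal.{0}} {f g : X → ℝ} (hf : OscRank μ f) (hg : OscRank μ g) :
    OscRank μ (fun x => f x - g x) := by
  simpa only [sub_eq_add_neg] using hf.add hg.neg

/-- Rounding down to multiples of `ε` preserves upper semicontinuity and gives values in `ℕ`, as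
`LevelRank.of_nat_levels` requires. -/
theorem eventually_floor_div_le {g : X → ℝ} (hg : UpperSemicontinuous g) {ε : ℝ} (hε : 0 < ε)
    (x : X) : ∀ᶠ y in 𝓝 x, ⌊g y / ε⌋₊ ≤ ⌊g x / ε⌋₊ := by
  have h1 : g x < (⌊g x / ε⌋₊ + 1) * ε := (div_lt_iff₀ hε).1 (Nat.lt_floor_add_one _)
  filter_upwards [hg x _ h1] with y hy
  rw [← Nat.lt_add_one_iff]
  exact (Nat.floor_lt' (Nat.succ_ne_zero _)).2 ((div_lt_iff₀ hε).2 (by push_cast; exact hy))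

theorem abs_sub_le_of_floor_div_eq {a b ε : ℝ} (hε : 0 < ε) (ha : 0 ≤ a) (hb : 0 ≤ b)
    (h : ⌊a / ε⌋₊ = ⌊b / ε⌋₊) : |a - b| ≤ ε := by
  have h1 := (le_div_iff₀ hε).1 (Nat.floor_le (div_nonneg ha hε.le))
  have h2 := (le_div_iff₀ hε).1 (Nat.floor_le (div_nonneg hb hε.le))
  have h3 := (div_lt_iff₀ hε).1 (Nat.lt_floor_add_one (a / ε))
  have h4 := (div_lt_iff₀ hε).1 (Nat.lt_floor_add_one (b / ε))
  rw [h] at h1 h3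
  rw [abs_le]
  constructor <;> linarith

theorem oscRank_of_upperSemicontinuous {g : X → ℝ} (hg : UpperSemicontinuous g) (h0 : 0 ≤ g) :
    OscRank 1 g := fun ε hε => by
  have h : LevelRank univ (1 * ω) (fun x y => |g y - g x| ≤ ε) :=
    .of_nat_levels (fun x => ⌊g x / ε⌋₊) (eventually_floor_div_le hg hε) fun k =>
      .of_forall zero_lt_one fun x hx y hy =>
        abs_sub_le_of_floor_div_eq hε (h0 y) (h0 x) (Eq.trans hy (Eq.symm hx))
  simpa using h

/-- The approximant may vary with the point: its rank serves on a neighbourhood, and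
`LevelRank.of_local` glues. -/
theorem LevelRank.of_local_approx {s : Set X} {κ : Ordinal.{0}} {ε δ : ℝ} {f : X → ℝ}
    (h : ∀ x ∈ s, ∃ g : X → ℝ, LevelRank univ κ (fun x y => |g y - g x| ≤ ε) ∧
      ∀ᶠ y in 𝓝[s] x, |f y - g y| ≤ δ) :
    LevelRank s κ (fun x y => |f y - f x| ≤ ε + 2 * δ) := by
  refine .of_local fun x hx => ?_
  obtain ⟨g, hg, hfg⟩ := h x hx
  obtain ⟨U, hU, hxU, hUs⟩ := mem_nhdsWithin.1 hfg
  refine ⟨U, hU, hxU, (hg.subset (subset_univ _)).mono le_rfl fun a ha b hb hab => ?_⟩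
  have h1 : |f a - g a| ≤ δ := hUs ⟨ha.2, ha.1⟩
  have h2 : |f b - g b| ≤ δ := hUs ⟨hb.2, hb.1⟩
  rw [abs_le] at *
  constructor <;> linarith

/-! ### Alternating sums have small oscillation rank. -/

/-- The alternating sum up to a limit power of `ω`, when the terms need not tend to zero. -/
theorem oscRank_altSum_block {g : Ordinal.{0} → X → ℝ} (hg : Antitone g) (h0 : ∀ η, 0 ≤ g η)
    (husc : ∀ η, UpperSemicontinuous (g η)) {μ : Ordinal.{0}} (h1 : 1 ≤ μ)
    (ih : ∀ ν < ω ^ μ, OscRank μ (altSum g (2 * ν))) :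
    OscRank (μ + 1) (altSum g (2 * ω ^ μ)) := fun ε hε => by
  have hlim : Order.IsSuccLimit (ω ^ μ) := isSuccLimit_omega0_opow h1
  have hne : Nonempty (Iio (ω ^ μ)) := ⟨⟨0, hlim.bot_lt⟩⟩
  have hδ : 0 < ε / 5 := by positivity
  have hbdd : ∀ x, BddBelow (range fun a : Iio (ω ^ μ) => g (2 * a.1) x) := fun x =>
    ⟨0, by rintro _ ⟨a, rfl⟩; exact h0 _ x⟩
  -- The infimum of the terms is again upper semicontinuous. On a level of its rounding it varies by
  -- at most `ε / 5`, so near `x` the tail after `2 * a` is at most `2 * (ε / 5)`.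
  obtain ⟨h, hh⟩ : ∃ h : X → ℝ, h = fun x => ⨅ a : Iio (ω ^ μ), g (2 * a.1) x := ⟨_, rfl⟩
  have hle : ∀ x, ∀ a < ω ^ μ, h x ≤ g (2 * a) x := fun x a ha => by
    rw [hh]
    exact ciInf_le (hbdd x) ⟨a, ha⟩
  have hh0 : ∀ x, 0 ≤ h x := fun x => by
    rw [hh]
    exact le_ciInf fun a => h0 _ x
  have hhusc : UpperSemicontinuous h := hh ▸ upperSemicontinuous_ciInf hbdd fun a => husc _
  rw [Ordinal.opow_add_one]
  refine .of_nat_levels (fun x => ⌊h x / (ε / 5)⌋₊) (eventually_floor_div_le hhusc hδ) fun k => ?_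
  refine (LevelRank.of_local_approx (ε := ε / 5) (δ := 2 * (ε / 5)) fun x hx => ?_).mono le_rfl
    fun _ _ _ _ h => h.trans_eq (by ring)
  have hlt : h x < h x + ε / 5 := by linarith
  obtain ⟨⟨a, ha⟩, hax⟩ : ∃ a : Iio (ω ^ μ), g (2 * a.1) x < h x + ε / 5 := by
    apply exists_lt_of_ciInf_lt
    rw [hh] at hlt ⊢
    exact hlt
  refine ⟨altSum g (2 * a), ih a ha _ hδ, ?_⟩
  filter_upwards [mem_nhdsWithin_of_mem_nhds (husc (2 * a) x _ hax), self_mem_nhdsWithin]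
    with y hy hys
  have h2 : |h y - h x| ≤ ε / 5 :=
    abs_sub_le_of_floor_div_eq hδ (hh0 y) (hh0 x) (Eq.trans hys (Eq.symm hx))
  have h3 := altSum_sub_le hg h0 y hlim ha (hle y)
  have ha' : a ≤ ω ^ μ := le_of_lt ha
  have h4 := altSum_mono hg h0 y ha'
  dsimp only at h4 hy
  rw [abs_of_nonneg (by linarith)]
  linarith [(abs_le.1 h2).1]

/-- No decay of the terms is assumed, so the induction applies to shifted sequences: below `ω ^ (μ +
1)` there are finitely many blocks of length `ω ^ μ`, then a shorter remainder. -/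
theorem oscRank_altSum_of_lt (μ : Ordinal.{0}) :
    ∀ g : Ordinal.{0} → X → ℝ, Antitone g → (∀ η, 0 ≤ g η) →
      (∀ η, UpperSemicontinuous (g η)) → ∀ ν < ω ^ μ, OscRank μ (altSum g (2 * ν)) := by
  induction μ using Ordinal.limitRecOn with
  | zero =>
    intro g _ _ _ ν hν
    rw [Ordinal.opow_zero, Order.lt_one_iff] at hν
    subst hν
    have h : altSum g (2 * 0) = fun _ => 0 := funext fun x => by rw [mul_zero, altSum_zero]
    exact h ▸ .const _ _
  | add_one μ ih =>
    intro g hg h0 husc ν hν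
    have hg' : ∀ a, Antitone fun η => g (a + η) := fun a η ζ h => hg (by gcongr)
    have hblock : ∀ g : Ordinal.{0} → X → ℝ, Antitone g → (∀ η, 0 ≤ g η) →
        (∀ η, UpperSemicontinuous (g η)) → OscRank (μ + 1) (altSum g (2 * ω ^ μ)) := by
      intro g hg h0 husc
      rcases (zero_le (a := μ)).eq_or_lt with rfl | hμ
      · have h : altSum g (2 * ω ^ (0 : Ordinal.{0})) = fun x => g 0 x - g 1 x := by
          funext x
          have := altSum_two_mul_add_one g 0 x
          simpa [altSum_zero] using this
        rw [h, zero_add]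
        exact (oscRank_of_upperSemicontinuous (husc 0) (h0 0)).sub
          (oscRank_of_upperSemicontinuous (husc 1) (h0 1))
      · exact oscRank_altSum_block hg h0 husc (Order.one_le_iff_pos.2 hμ) (ih g hg h0 husc)
    have hmul : ∀ k : ℕ, OscRank (μ + 1) (altSum g (2 * (ω ^ μ * k))) := by
      intro k
      induction k with
      | zero =>
        have h : altSum g (2 * (ω ^ μ * ((0 : ℕ) : Ordinal.{0}))) = fun _ => 0 :=
          funext fun x => by simp [altSum_zero]
        exact h ▸ .const _ _
      | succ k ihk =>
        have h := ihk.add (hblock _ (hg' (2 * (ω ^ μ * k))) (fun η => h0 _) fun η => husc _)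
        convert h using 2 with x
        rw [← altSum_two_mul_add hg h0]
        push_cast
        rw [mul_add, mul_one]
    rw [Ordinal.opow_add_one] at hν
    obtain ⟨k, hk⟩ := Ordinal.lt_omega0.1
      ((Ordinal.lt_mul_iff_div_lt (Ordinal.opow_ne_zero μ Ordinal.omega0_ne_zero)).1 hν)
    have h := (hmul k).add ((ih _ (hg' (2 * (ω ^ μ * k))) (fun η => h0 _) (fun η => husc _)
      (ν % ω ^ μ) (Ordinal.mod_lt _ (Ordinal.opow_ne_zero μ Ordinal.omega0_ne_zero))).mono
      (Order.le_succ μ))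
    convert h using 2 with x
    rw [← altSum_two_mul_add hg h0, ← hk, Ordinal.div_add_mod]
  | limit μ hμ ih =>
    intro g hg h0 husc ν hν
    obtain ⟨a, ha, hνa⟩ := (Ordinal.lt_opow_of_isSuccLimit Ordinal.omega0_ne_zero hμ).1 hν
    exact (ih a ha g hg h0 husc ν hνa).mono ha.le

theorem IsConstAddAltSum.oscRank {f : X → ℝ} {l μ : Ordinal.{0}} (h1 : 1 ≤ μ) (hl : l ≤ ω ^ μ)
    (h : IsConstAddAltSum f l) : OscRank μ f := by
  obtain ⟨g', c, hg', hf⟩ := h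
  classical
  -- Continuing by zero makes monotonicity and semicontinuity hold at all indices without changing
  -- the sum up to `l`.
  let g (η : Ordinal.{0}) : X → ℝ := if η < l then g' η else 0
  have hgg' : ∀ η < l, g η = g' η := fun η hη => if_pos hη
  have hg_zero : ∀ η, ¬ η < l → g η = 0 := fun η hη => if_neg hη
  have h0 : ∀ η, 0 ≤ g η := fun η => by
    by_cases hη : η < l
    · rw [hgg' η hη]
      exact hg'.nonneg η hη
    · rw [hg_zero η hη]
  have hg : Antitone g := fun η ζ h => by
    by_cases hζ : ζ < l
    · rw [hgg' ζ hζ, hgg' η (h.trans_lt hζ)]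
      exact hg'.decreasing η ζ h hζ
    · rw [hg_zero ζ hζ]
      exact h0 η
  have husc : ∀ η, UpperSemicontinuous (g η) := fun η => by
    by_cases hη : η < l
    · rw [hgg' η hη]
      exact hg'.usc η hη
    · rw [hg_zero η hη]
      exact upperSemicontinuous_const
  have hf' : f = fun x => c + altSum g l x := funext fun x => by
    rw [hf, altSum_congr fun η hη => congrFun (hgg' η hη).symm x]
  rw [hf']
  refine (OscRank.const μ c).add ?_
  have hlt := oscRank_altSum_of_lt μ g hg h0 husc
  rcases hl.eq_or_lt with rfl | hl
  · have hlim : Order.IsSuccLimit (ω ^ μ) := isSuccLimit_omega0_opow h1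
    have hne : Nonempty (Iio (ω ^ μ)) := ⟨⟨0, hlim.bot_lt⟩⟩
    have happ : OscRank μ (altSum g (2 * ω ^ μ)) := fun ε hε => by
      have hδ : 0 < ε / 3 := by positivity
      refine (LevelRank.of_local_approx (ε := ε / 3) (δ := ε / 3) fun x _ => ?_).mono le_rfl
        fun _ _ _ _ h => h.trans_eq (by ring)
      obtain ⟨⟨a, ha⟩, hax⟩ := ((hg'.tendsto_zero hlim x).eventually (gt_mem_nhds hδ)).exists
      have hax' : g (2 * a) x < ε / 3 := by
        refine (hg (Ordinal.le_mul_right a two_pos) x).trans_lt ?_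
        rw [hgg' a ha]
        exact hax
      refine ⟨altSum g (2 * a), hlt a ha _ hδ, ?_⟩
      filter_upwards [mem_nhdsWithin_of_mem_nhds (husc (2 * a) x _ hax')] with y hy
      have ha' : a ≤ ω ^ μ := le_of_lt ha
      have h3 := altSum_sub_le hg h0 y hlim ha fun b _ => h0 (2 * b) y
      have h4 := altSum_mono hg h0 y ha'
      dsimp only [Pi.zero_apply] at h3 h4 hy
      rw [abs_of_nonneg (by linarith)]
      linarith
    rwa [two_mul_omega0_opow h1] at happ
  · obtain ⟨ν, rfl | rfl⟩ := exists_eq_two_mul_or l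
    · exact hlt ν ((Ordinal.le_mul_right ν two_pos).trans_lt hl)
    · have hν : ν < ω ^ μ := ((Ordinal.le_mul_right ν two_pos).trans (Order.le_succ _)).trans_lt hl
      have h2 := (hlt ν hν).add ((oscRank_of_upperSemicontinuous (husc (2 * ν)) (h0 _)).mono h1)
      convert h2 using 2 with x
      rw [altSum_add_one, ordSign_two_mul, one_mul]

/-! ### From separated level sets to oscillation rank. -/

theorem SeparatedBy.levelRank {A B : Set X} {l κ : Ordinal.{0}} (h : SeparatedBy A B l)
    (hl : l ≤ κ) : LevelRank univ κ (fun x y => (x ∈ A → y ∉ B) ∧ (x ∈ B → y ∉ A)) := by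
  obtain ⟨F, hF, hA, hB⟩ := h
  refine hF.levelRank.mono hl fun x _ y _ hxy => ⟨fun hx => hB (hxy.1 (hA hx)), fun hx hy => ?_⟩
  exact hB (hxy.2 (hA hy)) hx

/-- Separation of all pairs of level sets bounds the oscillation rank. -/
theorem oscRank_of_separatedBy {f : X → ℝ} (hb : Bdd f) {μ : Ordinal.{0}}
    (h : ∀ p q : ℚ, p < q → ∃ l ≤ ω ^ μ, SeparatedBy {x | f x ≤ p} {x | q ≤ f x} l) :
    OscRank μ f := fun ε hε => by
  obtain ⟨C, hC⟩ := hb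
  obtain ⟨N, hN⟩ := exists_nat_gt (2 / ε)
  have hN0 : (0 : ℝ) < N := (by positivity : 0 < 2 / ε).trans hN
  have hN' : 2 / (N : ℝ) < ε := by
    rw [div_lt_iff₀ hN0]
    rwa [div_lt_iff₀ hε, mul_comm] at hN
  have hQ0 : (0 : ℚ) < N := by exact_mod_cast hN0
  -- The margin `2` keeps the indices `j - 1` and `j + 1` within the range `-K, …, K`, where `j = ⌊N
  -- * f x⌋`.
  obtain ⟨K, hK⟩ := exists_nat_gt (N * C + 2)
  have hall := LevelRank.forall_finset (Finset.Icc (-(K : ℤ)) K) (fun i _ => by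
    obtain ⟨l, hl, hsep⟩ := h ((i : ℚ) / N) (((i : ℚ) + 1) / N) (by gcongr; exact lt_add_one _)
    exact hsep.levelRank hl)
  refine hall.mono le_rfl fun x _ y _ hxy => ?_
  have hj1 := Int.floor_le (N * f x)
  have hj2 := Int.lt_floor_add_one (N * f x)
  have hfx := abs_le.1 (hC x)
  have hx1 : N * f x ≤ N * C := by gcongr; exact hfx.2
  have hx2 : -(N * C) ≤ N * f x := by
    rw [← mul_neg]
    gcongr
    exact hfx.1
  generalize ⌊N * f x⌋ = j at *
  have hjK : (j : ℝ) + 1 < K := by linarith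
  have hjK' : -(K : ℝ) < j - 1 := by linarith
  have hup := (hxy (j + 1) (Finset.mem_Icc.2
    ⟨by have : -(K : ℤ) < j - 1 := by exact_mod_cast hjK'
        omega, by exact_mod_cast hjK.le⟩)).1
  have hlow := (hxy (j - 1) (Finset.mem_Icc.2
    ⟨by exact_mod_cast hjK'.le, by have : j + 1 < (K : ℤ) := by exact_mod_cast hjK
                                   omega⟩)).2
  simp only [mem_ofPred_eq, not_le] at hup hlow
  push_cast at hup hlow
  rw [le_div_iff₀ hN0, lt_div_iff₀ hN0] at hup
  rw [div_le_iff₀ hN0, div_lt_iff₀ hN0] at hlow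
  have h1 := hup (by linarith)
  have h2 := hlow (by linarith)
  refine le_trans ?_ hN'.le
  rw [abs_le, ← neg_div, div_le_iff₀ hN0, le_div_iff₀ hN0]
  constructor <;> linarith

/-! ### Expansion into transfinite differences and superposition. -/

/-- A third of a function with oscillation rank `μ` is captured by a transfinite difference. -/
theorem OscRank.exists_step {f : X → ℝ} {μ : Ordinal.{0}} (h1 : 1 ≤ μ) (hμ : μ < ω₁)
    (hf : OscRank μ f) {r : ℝ} (hr : 0 < r) (h0 : ∀ x, 0 ≤ f x) (hfr : ∀ x, f x ≤ r) :
    ∃ F : Ordinal.{0} → Set X, IsClosedSeq (ω ^ μ) F ∧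
      OscRank μ (fun x => f x - r / 3 * (transDiff (ω ^ μ) F).indicator 1 x) ∧
      (∀ x, 0 ≤ f x - r / 3 * (transDiff (ω ^ μ) F).indicator 1 x) ∧
      ∀ x, f x - r / 3 * (transDiff (ω ^ μ) F).indicator 1 x ≤ 2 / 3 * r := by
  classical
  obtain ⟨F, hF, hA, hB⟩ := LevelRank.exists_isClosedSeq (A := {x | 2 / 3 * r ≤ f x})
    -- Any oscillation below the gap `r / 3` separates the two sets; `r / 4` is one choice.
    (B := {x | f x ≤ 1 / 3 * r}) h1 hμ ((hf (r / 4) (by positivity)).mono le_rfl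
      fun x _ y _ hxy hx hy => by
        simp only [mem_ofPred_eq] at hx hy
        linarith [(abs_le.1 hxy).1])
  refine ⟨F, hF, hf.sub fun ε hε => hF.levelRank.mono le_rfl fun x _ y _ hxy => ?_,
    fun x => ?_, fun x => ?_⟩
  · simp only [indicator_apply, hxy, Pi.one_apply, sub_self, abs_zero]
    exact hε.le
  · by_cases hx : x ∈ transDiff (ω ^ μ) F
    · have := hB hx
      simp only [mem_compl_iff, mem_ofPred_eq, not_le] at this
      rw [indicator_of_mem hx, Pi.one_apply]
      linarith
    · rw [indicator_of_notMem hx]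
      simpa using h0 x
  · by_cases hx : x ∈ transDiff (ω ^ μ) F
    · rw [indicator_of_mem hx, Pi.one_apply]
      linarith [hfr x]
    · have : ¬ 2 / 3 * r ≤ f x := fun h => hx (hA h)
      rw [indicator_of_notMem hx]
      linarith

/-- The step can be iterated because the remainder keeps its oscillation rank while its bound
shrinks by `2 / 3`. -/
theorem OscRank.exists_hasSum {f : X → ℝ} {μ : Ordinal.{0}} (h1 : 1 ≤ μ) (hμ : μ < ω₁)
    (hf : OscRank μ f) {r : ℝ} (hr : 0 < r) (h0 : ∀ x, 0 ≤ f x) (hfr : ∀ x, f x ≤ r) :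
    ∃ F : ℕ → Ordinal.{0} → Set X, (∀ n, IsClosedSeq (ω ^ μ) (F n)) ∧ ∀ x,
      HasSum (fun n => (2 / 3) ^ n * (r / 3) * (transDiff (ω ^ μ) (F n)).indicator 1 x) (f x) := by
  let S := {p : (X → ℝ) × ℝ // OscRank μ p.1 ∧ 0 < p.2 ∧ (∀ x, 0 ≤ p.1 x) ∧ ∀ x, p.1 x ≤ p.2}
  have hstep : ∀ p : S, ∃ F : Ordinal.{0} → Set X, IsClosedSeq (ω ^ μ) F ∧
      OscRank μ (fun x => p.1.1 x - p.1.2 / 3 * (transDiff (ω ^ μ) F).indicator 1 x) ∧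
      (∀ x, 0 ≤ p.1.1 x - p.1.2 / 3 * (transDiff (ω ^ μ) F).indicator 1 x) ∧
      ∀ x, p.1.1 x - p.1.2 / 3 * (transDiff (ω ^ μ) F).indicator 1 x ≤ 2 / 3 * p.1.2 :=
    fun p => p.2.1.exists_step h1 hμ p.2.2.1 p.2.2.2.1 p.2.2.2.2
  choose Φ hΦ hosc hnn hle using hstep
  let next (p : S) : S := ⟨(fun x => p.1.1 x - p.1.2 / 3 * (transDiff (ω ^ μ) (Φ p)).indicator 1 x,
    2 / 3 * p.1.2), hosc p, by have := p.2.2.1; positivity, hnn p, hle p⟩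
  let s (n : ℕ) : S := next^[n] ⟨(f, r), hf, hr, h0, hfr⟩
  have hs : ∀ n, s (n + 1) = next (s n) := fun n => Function.iterate_succ_apply' _ _ _
  have hr' : ∀ n, (s n).1.2 = (2 / 3) ^ n * r := fun n => by
    induction n with
    | zero => simp [s]
    | succ n ih =>
      rw [hs]
      change 2 / 3 * (s n).1.2 = _
      rw [ih]
      ring
  refine ⟨fun n => Φ (s n), fun n => hΦ _, fun x => ?_⟩
  have hpart : ∀ n, ∑ i ∈ Finset.range n,
      (2 / 3) ^ i * (r / 3) * (transDiff (ω ^ μ) (Φ (s i))).indicator 1 x = f x - (s n).1.1 x := by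
    intro n
    induction n with
    | zero => simp [s]
    | succ n ih =>
      have h2 : (s (n + 1)).1.1 x = (s n).1.1 x -
          (s n).1.2 / 3 * (transDiff (ω ^ μ) (Φ (s n))).indicator 1 x := by rw [hs]
      rw [Finset.sum_range_succ, ih, h2, hr']
      ring
  refine (hasSum_iff_tendsto_nat_of_nonneg (fun i => mul_nonneg (by positivity)
    (indicator_nonneg (f := 1) (fun _ _ => zero_le_one) x)) _).2 ?_
  simp only [hpart]
  have h3 : Tendsto (fun n => (s n).1.1 x) atTop (𝓝 0) := by
    refine squeeze_zero (fun n => (s n).2.2.2.1 x)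
      (fun n => ((s n).2.2.2.2 x).trans_eq (hr' n)) ?_
    simpa using (tendsto_pow_atTop_nhds_zero_of_lt_one (by norm_num : (0 : ℝ) ≤ 2 / 3)
      (by norm_num)).mul_const r
  simpa using h3.const_sub (f x)

/-- Finitely many terms cannot increase near `x`, as the sets are closed; the remaining terms are
bounded by a small tail of `c`. -/
theorem upperSemicontinuous_tsum_indicator {c : ℕ → ℝ} (hc : Summable c) (hc0 : ∀ n, 0 ≤ c n)
    {F : ℕ → Set X} (hF : ∀ n, IsClosed (F n)) :
    UpperSemicontinuous fun x => ∑' n, c n * (F n).indicator 1 x := by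
  have hle : ∀ n x, c n * (F n).indicator 1 x ≤ c n := fun n x =>
    mul_le_of_le_one_right (hc0 n) (indicator_le_self' (fun _ _ => zero_le_one) x)
  have hnn : ∀ n x, 0 ≤ c n * (F n).indicator 1 x := fun n x =>
    mul_nonneg (hc0 n) (indicator_nonneg (fun _ _ => zero_le_one) x)
  have hsum : ∀ x, Summable fun n => c n * (F n).indicator 1 x := fun x =>
    hc.of_nonneg_of_le (fun n => hnn n x) fun n => hle n x
  intro x a ha
  obtain ⟨s, hs⟩ : ∃ s : Finset ℕ, ∑' n : {n // n ∉ s}, c n < a - ∑' n, c n * (F n).indicator 1 x :=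
    ((tendsto_tsum_compl_atTop_zero c).eventually (gt_mem_nhds (sub_pos.2 ha))).exists
  have hev : ∀ᶠ y in 𝓝 x, ∀ n ∈ s, c n * (F n).indicator 1 y ≤ c n * (F n).indicator 1 x := by
    refine (Filter.eventually_all_finset s).2 fun n _ => ?_
    by_cases hx : x ∈ F n
    · refine .of_forall fun y => ?_
      rw [indicator_of_mem hx, Pi.one_apply, mul_one]
      exact hle n y
    · filter_upwards [(hF n).isOpen_compl.mem_nhds hx] with y hy
      rw [indicator_of_notMem hx, indicator_of_notMem hy]
  filter_upwards [hev] with y hy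
  calc ∑' n, c n * (F n).indicator 1 y
      = ∑ n ∈ s, c n * (F n).indicator 1 y + ∑' n : {n // n ∉ s}, c n * (F n).indicator 1 y :=
        ((hsum y).sum_add_tsum_subtype_compl s).symm
    _ ≤ ∑ n ∈ s, c n * (F n).indicator 1 x + ∑' n : {n // n ∉ s}, c n :=
        add_le_add (Finset.sum_le_sum hy) (((hsum y).subtype _).tsum_le_tsum
          (fun n => hle n y) (hc.subtype _))
    _ ≤ ∑' n, c n * (F n).indicator 1 x + ∑' n : {n // n ∉ s}, c n :=
        add_le_add ((hsum x).sum_le_tsum s fun n _ => hnn n x) le_rfl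
    _ < a := by linarith

theorem OscRank.isConstAddAltSum {f : X → ℝ} (hb : Bdd f) {μ : Ordinal.{0}} (h1 : 1 ≤ μ)
    (hμ : μ < ω₁) (hf : OscRank μ f) : IsConstAddAltSum f (ω ^ μ) := by
  obtain ⟨C, hC⟩ := hb
  -- Adding `|C|` makes `f` non-negative and at most `2 * |C|`; the extra `1` keeps the bound
  -- positive when `C = 0`.
  have hr : 0 < 2 * |C| + 1 := by positivity
  obtain ⟨F, hF, hsum⟩ := ((OscRank.const μ |C|).add hf).exists_hasSum h1 hμ hr
    (fun x => by linarith [(abs_le.1 (hC x)).1, le_abs_self C])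
    (fun x => by linarith [(abs_le.1 (hC x)).2, le_abs_self C])
  generalize 2 * |C| + 1 = r at *
  let c (n : ℕ) : ℝ := (2 / 3) ^ n * (r / 3)
  have hc : Summable c := (summable_geometric_of_lt_one (by norm_num) (by norm_num)).mul_right _
  have hc0 : ∀ n, 0 ≤ c n := fun n => by positivity
  let G (n : ℕ) (η : Ordinal.{0}) : X → ℝ := (F n η).indicator 1
  have hG : ∀ n, Antitone (G n) := fun n η ζ h =>
    indicator_le_indicator_of_subset ((hF n).antitone h) fun _ => zero_le_one
  have hG0 : ∀ n η, 0 ≤ G n η := fun n η => indicator_nonneg fun _ _ => zero_le_one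
  have hG1 : ∀ n η x, G n η x ≤ 1 := fun n η x => indicator_le_self' (fun _ _ => zero_le_one) x
  have hle : ∀ n η x, c n * G n η x ≤ c n := fun n η x =>
    mul_le_of_le_one_right (hc0 n) (hG1 n η x)
  have hnn : ∀ n η x, 0 ≤ c n * G n η x := fun n η x => mul_nonneg (hc0 n) (hG0 n η x)
  have hs : ∀ η x, Summable fun n => c n * G n η x := fun η x =>
    hc.of_nonneg_of_le (fun n => hnn n η x) fun n => hle n η x
  refine ⟨fun η x => ∑' n, c n * G n η x, -|C|, ⟨omega0_opow_lt_omega_one hμ, fun η _ =>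
    upperSemicontinuous_tsum_indicator hc hc0 fun n => (hF n).isClosed' η,
    fun η _ x => tsum_nonneg fun n => hnn n η x, fun η _ => ⟨∑' n, c n, fun x => ?_⟩,
    fun η ζ h _ x => (hs ζ x).tsum_le_tsum
      (fun n => mul_le_mul_of_nonneg_left (hG n h x) (hc0 n)) (hs η x),
    fun _ x => ?_⟩, fun x => ?_⟩
  · rw [abs_of_nonneg (tsum_nonneg fun n => hnn n η x)]
    exact (hs η x).tsum_le_tsum (fun n => hle n η x) hc
  · have hlim : Order.IsSuccLimit (ω ^ μ) := isSuccLimit_omega0_opow h1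
    have h : Tendsto (fun η : Iio (ω ^ μ) => ∑' n, c n * G n η.1 x) atTop (𝓝 (∑' _ : ℕ, 0)) := by
      refine tendsto_tsum_of_dominated_convergence hc (fun n => ?_) (.of_forall fun η n => ?_)
      · obtain ⟨η, hη, -, hx⟩ := (hF n).exists_last x
        refine tendsto_const_nhds.congr' ?_
        filter_upwards [eventually_ge_atTop (⟨η + 1, hlim.add_one_lt hη⟩ : Iio (ω ^ μ))] with ζ hζ
        have hζ' : η + 1 ≤ ζ.1 := hζ
        simp only [G, indicator_of_notMem fun h => hx ((hF n).antitone hζ' h), mul_zero]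
      · rw [Real.norm_of_nonneg (hnn n _ x)]
        exact hle n _ x
    simpa using h
  · have h2 := altSum_tsum hc hc0 hG hG0 (fun n => hG1 n 0) (ω ^ μ) x
    simp only [G, altSum_indicator (fun η ζ h => (hF _).antitone h)] at h2
    simp only [two_mul_omega0_opow h1] at h2
    simp only [G, h2]
    rw [(hsum x).tsum_eq]
    ring

/-! ### Ranks as attained minima, and the equivalence. -/

theorem SeparatedBy.exists_of_sepRank_le {A B : Set X} {κ : Ordinal.{0}} (hκ : κ < ω₁)
    (h : sepRank A B ≤ κ) : ∃ l ≤ κ, SeparatedBy A B l := by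
  have hmem : sepRank A B ∈ insert ω₁ {l | SeparatedBy A B l} := csInf_mem (insert_nonempty _ _)
  -- The default value `ω₁` is excluded by `κ < ω₁`, so the infimum is a genuine length.
  rcases hmem with h' | h'
  · exact absurd (h'.symm.trans_le h) (not_le.2 hκ)
  · exact ⟨_, h, h'⟩

theorem modSepRank_le_iff {f : X → ℝ} {κ : Ordinal.{0}} (hκ : κ < ω₁) :
    modSepRank f ≤ κ ↔
      ∀ p q : ℚ, p < q → ∃ l ≤ κ, SeparatedBy {x | f x ≤ p} {x | q ≤ f x} l := by
  constructor
  · intro h p q hpq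
    refine SeparatedBy.exists_of_sepRank_le hκ (le_trans ?_ h)
    exact Ordinal.le_iSup (fun r : {r : ℚ × ℚ // r.1 < r.2} =>
      sepRank {x | f x ≤ ((r.1.1 : ℚ) : ℝ)} {x | ((r.1.2 : ℚ) : ℝ) ≤ f x}) ⟨(p, q), hpq⟩
  · intro h
    refine Ordinal.iSup_le fun r => ?_
    obtain ⟨l, hl, hsep⟩ := h r.1.1 r.1.2 r.2
    exact (csInf_le' (s := insert ω₁ {l | SeparatedBy _ _ l}) (Or.inr hsep)).trans hl

theorem altLength_le_iff {f : X → ℝ} {κ : Ordinal.{0}} (hκ : κ < ω₁) :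
    altLength f ≤ κ ↔ ∃ l ≤ κ, IsConstAddAltSum f l := by
  constructor
  · intro h
    have hmem : altLength f ∈ insert ω₁ {l | IsConstAddAltSum f l} :=
      csInf_mem (insert_nonempty _ _)
    rcases hmem with h' | h'
    · exact absurd (h'.symm.trans_le h) (not_le.2 hκ)
    · exact ⟨_, h, h'⟩
  · rintro ⟨l, hl, h⟩
    exact (csInf_le' (s := insert ω₁ {l | IsConstAddAltSum f l}) (Or.inr h)).trans hl

theorem OscRank.separatedBy {f : X → ℝ} {μ : Ordinal.{0}} (h1 : 1 ≤ μ) (hμ : μ < ω₁)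
    (hf : OscRank μ f) {p q : ℝ} (hpq : p < q) :
    SeparatedBy {x | f x ≤ p} {x | q ≤ f x} (ω ^ μ) := by
  refine LevelRank.exists_isClosedSeq h1 hμ ((hf ((q - p) / 2) (by linarith)).mono le_rfl
    fun x _ y _ hxy hx hy => ?_)
  simp only [mem_ofPred_eq] at hx hy
  linarith [(abs_le.1 hxy).2]

theorem mem_baireOneRankClass_iff {f : X → ℝ} (hf : BaireOne f) (hb : Bdd f) {μ : Ordinal.{0}}
    (h1 : 1 ≤ μ) (hμ : μ < ω₁) :
    f ∈ BaireOneRankClass X μ ↔ ∃ l ≤ ω ^ μ, IsConstAddAltSum f l := by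
  have hκ := omega0_opow_lt_omega_one hμ
  constructor
  · rintro ⟨-, -, h⟩
    exact ⟨_, le_rfl, (oscRank_of_separatedBy hb ((modSepRank_le_iff hκ).1 h)).isConstAddAltSum
      hb h1 hμ⟩
  · rintro ⟨l, hl, h⟩
    exact ⟨hf, hb, (modSepRank_le_iff hκ).2 fun p q hpq =>
      ⟨_, le_rfl, (h.oscRank h1 hl).separatedBy h1 hμ (by exact_mod_cast hpq)⟩⟩

end OscRank

end AltSum

end

theorem mainTheorem1 {X : Type*} [TopologicalSpace X] [PolishSpace X]
    (f : X → ℝ) (hf : AltSum.BaireOne f) (hb : AltSum.Bdd f)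
    (lam : Ordinal.{0}) (h1 : 1 ≤ lam) (hlam : lam < ω₁) :
    (f ∈ AltSum.BaireOneRankClass X lam ↔ AltSum.altLength f ≤ ω ^ lam) ∧
    (f ∈ AltSum.BaireOneRankClass X lam ↔ ∃ l ≤ ω ^ lam, AltSum.IsConstAddAltSum f l) := by
  have h := AltSum.mem_baireOneRankClass_iff hf hb h1 hlam
  exact ⟨h.trans (AltSum.altLength_le_iff (AltSum.omega0_opow_lt_omega_one hlam)).symm, h⟩
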